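/- Let $m,r\ge 1$ and let all random elements be defined on one probability space. For each $n\ge1$ let $X_{n,1},X_{n,2},\dots$ be independent random vectors in $\mathbb{R}^r$, let $T_{n,k}=T_{n,k}(X_{n,1},\dots,X_{n,k})\in\mathbb{R}^m$, $k\ge 1$, be measurable functions of the observations (statistics), let $\theta_n\in\mathbb{R}^m$ and $\sigma_n>0$, and let $N_n$ be an integer random variable with $N_n\ge1$ almost surely which, for each $k\ge1$, is independent of $T_{n,k}-\theta_n$. Put $T_{n,N_n}(\omega)=T_{n,N_n(\omega)}(X_{n,1}(\omega),\dots,X_{n,N_n(\omega)}(\omega))$. Let $a_n\to a$ and $b_n\to b$ in $\mathbb{R}^m$, let $h_{n,k}$ be the characteristic function of $\sigma_n\sqrt{k}\,(T_{n,k}-\theta_n)-\sqrt{n/k}\,a_n$, and assume: (i) the family $\{n/N_n\}_{n\ge1}$ is weakly relatively compact (every sequence of its elements contains a weakly convergent subsequence); (ii) there is a symmetric positive definite $m\times m$ matrix $\Sigma$ such that for every $R\in(0,\infty)$ $$\lim_{n\to\infty}\mathsf{E}\sup_{\|t\|\le R}\bigl|h_{n,N_n}(t)-\exp\{-\tfrac12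 t^{\top}\Sigma t\}\bigr|=0 .$$ For $\nu\in\mathbb{R}$ and $\mu,\lambda$ with $\mu>0,\lambda\ge0$ if $\nu<0$; $\mu>0,\lambda>0$ if $\nu=0$; $\mu\ge0,\lambda>0$ if $\nu>0$, let $GIG_{\nu,\mu,\lambda}$ (generalized inverse Gaussian law) be the probability law on $(0,\infty)$ whose density is proportional to $x^{\nu-1}\exp\{-\frac12(\mu/x+\lambda x)\}$. For $\alpha\ge 0$ and $c,d\in\mathbb{R}^m$ such that $\langle c,\Sigma c\rangle\le\alpha^2$ (with strict inequality if $\nu\ge0$) and the parameters $\nu$, $\mu$, $\sqrt{\alpha^2-\langle c,\Sigma c\rangle}$ are admissible for $GIG$, let $GH_{\nu,\mu,\alpha,c,d,\Sigma}$ (multivariate generalized hyperbolic law) be the normal variance-mean mixture $$GH_{\nu,\mu,\alpha,c,d,\Sigma}(\cdot)=\int_0^\infty \mathcal{N}_{d+z\Sigma c,\;z\Sigma}(\cdot)\;GIG_{\nu,\mu,\sqrt{\alpha^2-\langle c,\Sigma c\rangle}}(dz),$$ where $\mathcal{N}_{u,V}$ is the normal law on $\mathbb{R}^m$ with mean $u$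 and covariance matrix $V$. Then, for all $\nu,\mu,\alpha$ such that the parameters of $GH_{\nu,\mu,\alpha,\Sigma^{-1}a,-b,\Sigma}$ are admissible, the law of $\sigma_n\sqrt{n}\,(T_{n,N_n}-\theta_n)-b_n$ converges weakly to $GH_{\nu,\mu,\alpha,\Sigma^{-1}a,-b,\Sigma}$ as $n\to\infty$ if and only if the law of $N_n/n$ converges weakly to $GIG_{-\nu,\lambda,\mu}$, where $\lambda=\sqrt{\alpha^2-\langle a,\Sigma^{-1}a\rangle}$. -/

import Mathlib

open MeasureTheory ProbabilityTheory Filter Set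
open scoped Topology

/-! ### The generalized inverse Gaussian law -/

/-- The unnormalized density `x ^ (ν - 1) * exp (- (μ / x + lam * x) / 2)`, used for `x > 0`. -/
noncomputable def gigKernel (ν μ lam x : ℝ) : ℝ :=
  x ^ (ν - 1) * Real.exp (-(1 / 2) * (μ / x + lam * x))

/-- The normalizing constant. For `μ, lam > 0` it equals `2 (μ / lam) ^ (ν / 2) K_ν (√(μ lam))`,
see `gigNorm_eq`; in the boundary cases `μ = 0` and `lam = 0` it gives the gamma and the inverse
gamma laws. -/
noncomputable def gigNorm (ν μ lam : ℝ) : ℝ :=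
  ∫ x in Ioi (0 : ℝ), gigKernel ν μ lam x

/-- The modified Bessel function of the third kind with index `ν`, at `z > 0`. -/
noncomputable def besselK (ν z : ℝ) : ℝ :=
  (1 / 2) * ∫ y in Ioi (0 : ℝ), y ^ (ν - 1) * Real.exp (-(z / 2) * (y + 1 / y))

/-- The admissible parameters of the generalized inverse Gaussian law. -/
def GIGParam (ν μ lam : ℝ) : Prop :=
  (ν < 0 → 0 < μ ∧ 0 ≤ lam) ∧ (ν = 0 → 0 < μ ∧ 0 < lam) ∧ (0 < ν → 0 ≤ μ ∧ 0 < lam)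

/-- The generalized inverse Gaussian law, as a measure on `ℝ` carried by `(0, ∞)`. -/
noncomputable def gigMeasure (ν μ lam : ℝ) : Measure ℝ :=
  (volume.restrict (Ioi (0 : ℝ))).withDensity
    fun x => ENNReal.ofReal (gigKernel ν μ lam x / gigNorm ν μ lam)

/-- For positive `μ` and `lam` the normalization is the classical one by Bessel functions. -/
theorem gigNorm_eq {ν μ lam : ℝ} (hμ : 0 < μ) (hl : 0 < lam) :
    gigNorm ν μ lam = 2 * (μ / lam) ^ (ν / 2) * besselK ν (√(μ * lam)) := by
  set c : ℝ := √(μ / lam) with hc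
  have hc0 : 0 < c := Real.sqrt_pos.2 (div_pos hμ hl)
  have hsμ := Real.sqrt_pos.2 hμ
  have hsl := Real.sqrt_pos.2 hl
  have e1 : μ / c = √(μ * lam) := by
    rw [hc, Real.sqrt_div hμ.le, Real.sqrt_mul hμ.le]
    field_simp
    rw [Real.sq_sqrt hμ.le]
  have e2 : lam * c = √(μ * lam) := by
    rw [hc, Real.sqrt_div hμ.le, Real.sqrt_mul hμ.le]
    field_simp
    rw [Real.sq_sqrt hl.le]
  have e3 : c ^ ν = (μ / lam) ^ (ν / 2) := by
    rw [hc, Real.sqrt_eq_rpow, ← Real.rpow_mul (div_pos hμ hl).le]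
    congr 1
    ring
  have h := integral_comp_mul_left_Ioi (fun x => gigKernel ν μ lam x) 0 hc0
  rw [mul_zero, smul_eq_mul] at h
  have h2 : gigNorm ν μ lam = c * ∫ x in Ioi (0 : ℝ), gigKernel ν μ lam (c * x) := by
    rw [h, gigNorm, ← mul_assoc, mul_inv_cancel₀ hc0.ne', one_mul]
  rw [h2, besselK, ← e3]
  have h3 : ∀ x ∈ Ioi (0 : ℝ), gigKernel ν μ lam (c * x) =
      c ^ (ν - 1) * (x ^ (ν - 1) * Real.exp (-(√(μ * lam) / 2) * (x + 1 / x))) := by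
    intro x hx
    have hx' : (0 : ℝ) < x := hx
    rw [gigKernel, Real.mul_rpow hc0.le hx'.le, mul_assoc]
    have e4 : μ / (c * x) = √(μ * lam) * (1 / x) := by
      rw [← e1]; field_simp
    have e5 : lam * (c * x) = √(μ * lam) * x := by
      rw [← e2]; ring
    rw [e4, e5]
    congr 3
    ring
  rw [setIntegral_congr_fun measurableSet_Ioi h3, integral_const_mul, Real.rpow_sub_one hc0.ne']
  field_simp

theorem gigKernel_nonneg {ν μ lam x : ℝ} (hx : 0 < x) : 0 ≤ gigKernel ν μ lam x :=
  mul_nonneg (Real.rpow_nonneg hx.le _) (Real.exp_pos _).le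

theorem gigKernel_pos {ν μ lam x : ℝ} (hx : 0 < x) : 0 < gigKernel ν μ lam x :=
  mul_pos (Real.rpow_pos_of_pos hx _) (Real.exp_pos _)

theorem measurable_gigKernel (ν μ lam : ℝ) : Measurable (gigKernel ν μ lam) := by
  unfold gigKernel
  fun_prop

theorem GIGParam.neg {ν μ lam : ℝ} (h : GIGParam ν μ lam) : GIGParam (-ν) lam μ := by
  obtain ⟨h1, h2, h3⟩ := h
  refine ⟨fun hν => ?_, fun hν => ?_, fun hν => ?_⟩
  · exact (h3 (by linarith)).symm
  · exact (h2 (by linarith)).symm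
  · exact (h1 (by linarith)).symm

theorem integrableOn_gigKernel_of_pos {ν μ lam : ℝ} (hν : 0 < ν) (hμ : 0 ≤ μ) (hl : 0 < lam) :
    IntegrableOn (gigKernel ν μ lam) (Ioi 0) := by
  have h := integrableOn_rpow_mul_exp_neg_mul_rpow (p := 1) (s := ν - 1) (b := lam / 2)
    (by linarith) one_pos (by positivity)
  refine Integrable.mono' h (measurable_gigKernel _ _ _).aestronglyMeasurable ?_
  filter_upwards [ae_restrict_mem measurableSet_Ioi] with x hx
  have hx' : (0 : ℝ) < x := hx
  rw [Real.norm_of_nonneg (gigKernel_nonneg hx'), gigKernel, Real.rpow_one]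
  refine mul_le_mul_of_nonneg_left (Real.exp_le_exp.2 ?_) (Real.rpow_nonneg hx'.le _)
  have : 0 ≤ μ / x := by positivity
  linarith

theorem integrableOn_gigKernel {ν μ lam : ℝ} (h : GIGParam ν μ lam) :
    IntegrableOn (gigKernel ν μ lam) (Ioi 0) := by
  rcases lt_trichotomy ν 0 with hν | hν | hν
  · obtain ⟨hμ, hl⟩ := h.1 hν
    have h1 := integrableOn_gigKernel_of_pos (ν := -ν) (μ := lam) (lam := μ) (by linarith) hl hμ
    rw [← integrableOn_Ioi_comp_rpow_iff (gigKernel (-ν) lam μ) (p := -1) (by norm_num)] at h1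
    refine h1.congr_fun (fun x hx => ?_) measurableSet_Ioi
    have hx' : (0 : ℝ) < x := hx
    simp only [gigKernel, smul_eq_mul, Real.rpow_neg_one]
    rw [Real.inv_rpow hx'.le, ← Real.rpow_neg hx'.le, ← mul_assoc]
    congr 1
    · rw [abs_neg, abs_one, one_mul, ← Real.rpow_add hx']
      congr 1
      ring
    · congr 1
      field_simp
      ring
  · subst hν
    obtain ⟨hμ, hl⟩ := h.2.1 rfl
    have h1 := (integrableOn_gigKernel_of_pos (ν := 1) (μ := 0) one_pos le_rfl hl).const_mul (2 / μ)
    refine Integrable.mono' h1 (measurable_gigKernel _ _ _).aestronglyMeasurable ?_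
    filter_upwards [ae_restrict_mem measurableSet_Ioi] with x hx
    have hx' : (0 : ℝ) < x := hx
    rw [Real.norm_of_nonneg (gigKernel_nonneg hx'), gigKernel, gigKernel]
    have e1 : Real.exp (-(1 / 2) * (μ / x + lam * x)) =
        Real.exp (-(μ / (2 * x))) * Real.exp (-(1 / 2) * (0 / x + lam * x)) := by
      rw [← Real.exp_add]
      congr 1
      field_simp
      ring
    have e2 : Real.exp (-(μ / (2 * x))) ≤ 2 / μ * x := by
      rw [Real.exp_neg, inv_le_comm₀ (Real.exp_pos _) (by positivity)]
      have := Real.add_one_le_exp (μ / (2 * x))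
      have e : (2 / μ * x)⁻¹ = μ / (2 * x) := by field_simp
      rw [e]
      linarith
    rw [e1, zero_sub, Real.rpow_neg_one, sub_self, Real.rpow_zero, one_mul, ← mul_assoc]
    refine mul_le_mul_of_nonneg_right ?_ (Real.exp_pos _).le
    rw [inv_mul_le_iff₀ hx']
    linarith
  · obtain ⟨hμ, hl⟩ := h.2.2 hν
    exact integrableOn_gigKernel_of_pos hν hμ hl

theorem gigNorm_pos {ν μ lam : ℝ} (h : GIGParam ν μ lam) : 0 < gigNorm ν μ lam := by
  rw [gigNorm, setIntegral_pos_iff_support_of_nonneg_ae _ (integrableOn_gigKernel h)]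
  · have : Ioi (0 : ℝ) ⊆ Function.support (gigKernel ν μ lam) := fun x hx =>
      (gigKernel_pos hx).ne'
    rw [inter_eq_right.2 this]
    simp
  · filter_upwards [ae_restrict_mem measurableSet_Ioi] with x hx
    exact gigKernel_nonneg hx

theorem isProbabilityMeasure_gigMeasure {ν μ lam : ℝ} (h : GIGParam ν μ lam) :
    IsProbabilityMeasure (gigMeasure ν μ lam) := by
  constructor
  rw [gigMeasure, withDensity_apply _ MeasurableSet.univ, Measure.restrict_univ,
    ← ofReal_integral_eq_lintegral_ofReal ((integrableOn_gigKernel h).div_const _)]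
  · rw [integral_div]
    change ENNReal.ofReal (gigNorm ν μ lam / gigNorm ν μ lam) = 1
    rw [div_self (gigNorm_pos h).ne', ENNReal.ofReal_one]
  · filter_upwards [ae_restrict_mem measurableSet_Ioi] with x hx
    exact div_nonneg (gigKernel_nonneg hx) (gigNorm_pos h).le

/-- The generalized inverse Gaussian law `GIG_{ν, μ, lam}`. -/
noncomputable def GIG (ν μ lam : ℝ) (h : GIGParam ν μ lam) : ProbabilityMeasure ℝ :=
  ⟨gigMeasure ν μ lam, isProbabilityMeasure_gigMeasure h⟩

/-! ### Normal variance-mean mixtures and the generalized hyperbolic law -/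

section Mixture

variable {m : ℕ}

/-- The normal variance-mean mixture `∫ N_{b + z a, z S} G(dz)` with mixing law `G`. -/
noncomputable def normalMixture (a b : EuclideanSpace ℝ (Fin m)) (S : Matrix (Fin m) (Fin m) ℝ)
    (G : Measure ℝ) : Measure (EuclideanSpace ℝ (Fin m)) :=
  G.bind fun z => multivariateGaussian (b + z • a) (z • S)

/-- `N_{c, z S}` is the law of `c + √z Y` where `Y` has the law `N_{0, S}`. -/
theorem multivariateGaussian_smul {S : Matrix (Fin m) (Fin m) ℝ} (hS : S.PosDef) {z : ℝ}
    (hz : 0 ≤ z) (c : EuclideanSpace ℝ (Fin m)) :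
    multivariateGaussian c (z • S) =
      (multivariateGaussian 0 S).map (fun y => c + √z • y) := by
  have hm : (multivariateGaussian 0 S).map (fun y => c + √z • y) =
      ((multivariateGaussian 0 S).map (fun y => √z • y)).map (fun y => c + y) := by
    rw [Measure.map_map (by fun_prop) (by fun_prop)]
    rfl
  have : IsProbabilityMeasure ((multivariateGaussian 0 S).map (fun y => c + √z • y)) :=
    Measure.isProbabilityMeasure_map (by fun_prop)
  apply Measure.ext_of_charFun
  ext t
  have h2 : charFun ((multivariateGaussian 0 S).map (fun y => c + √z • y)) t =
      Complex.exp (inner ℝ c t * Complex.I) * charFun (multivariateGaussian 0 S) (√z • t) := by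
    rw [charFun_apply, charFun_apply, integral_map (by fun_prop) (by fun_prop),
      ← integral_const_mul]
    congr 1
    ext y
    rw [← Complex.exp_add, inner_add_left, real_inner_smul_left, real_inner_smul_right]
    push_cast
    congr 1
    ring
  have hz2 : (√z) ^ 2 = z := Real.sq_sqrt hz
  rw [h2, charFun_multivariateGaussian hS.posSemidef,
    charFun_multivariateGaussian (hS.posSemidef.smul hz), ← Complex.exp_add]
  congr 1
  rw [inner_zero_right, real_inner_comm]
  simp only [WithLp.ofLp_smul, Matrix.smul_mulVec, Matrix.mulVec_smul, dotProduct_smul,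
    smul_dotProduct, smul_eq_mul]
  rw [← mul_assoc, ← sq, hz2]
  push_cast
  ring

theorem aemeasurable_mixtureKernel {S : Matrix (Fin m) (Fin m) ℝ} (hS : S.PosDef)
    (a b : EuclideanSpace ℝ (Fin m)) {G : Measure ℝ} (hG : ∀ᵐ z ∂G, 0 ≤ z) :
    AEMeasurable (fun z => multivariateGaussian (b + z • a) (z • S)) G := by
  refine ⟨fun z => (multivariateGaussian 0 S).map (fun y => (b + z • a) + √z • y), ?_, ?_⟩
  · have hf : Measurable (fun p : ℝ × EuclideanSpace ℝ (Fin m) => (b + p.1 • a) + √p.1 • p.2) := by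
      fun_prop
    refine Measure.measurable_of_measurable_coe _ fun s hs => ?_
    have h := measurable_measure_prodMk_left (ν := multivariateGaussian 0 S) (hf hs)
    convert h using 2 with z
    rw [Measure.map_apply (by fun_prop) hs]
    rfl
  · filter_upwards [hG] with z hz
    exact multivariateGaussian_smul hS hz _

theorem isProbabilityMeasure_normalMixture {S : Matrix (Fin m) (Fin m) ℝ} (hS : S.PosDef)
    (a b : EuclideanSpace ℝ (Fin m)) {G : Measure ℝ} [IsProbabilityMeasure G]
    (hG : ∀ᵐ z ∂G, 0 ≤ z) : IsProbabilityMeasure (normalMixture a b S G) := by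
  constructor
  rw [normalMixture, Measure.bind_apply MeasurableSet.univ (aemeasurable_mixtureKernel hS a b hG)]
  simp

theorem ae_nonneg_gigMeasure (ν μ lam : ℝ) : ∀ᵐ z ∂(gigMeasure ν μ lam), 0 ≤ z := by
  refine (withDensity_absolutelyContinuous _ _).ae_le ?_
  filter_upwards [ae_restrict_mem measurableSet_Ioi] with x hx
  exact le_of_lt hx

/-- The admissible parameters of the generalized hyperbolic law. -/
def GHParam (ν μ α : ℝ) (a : EuclideanSpace ℝ (Fin m)) (S : Matrix (Fin m) (Fin m) ℝ) : Prop :=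
  0 ≤ α ∧
  (ν < 0 → 0 < μ ∧ inner ℝ a (Matrix.toEuclideanCLM (𝕜 := ℝ) S a) ≤ α ^ 2) ∧
  (ν = 0 → 0 < μ ∧ inner ℝ a (Matrix.toEuclideanCLM (𝕜 := ℝ) S a) < α ^ 2) ∧
  (0 < ν → 0 ≤ μ ∧ inner ℝ a (Matrix.toEuclideanCLM (𝕜 := ℝ) S a) < α ^ 2)

theorem GHParam.gigParam {ν μ α : ℝ} {a : EuclideanSpace ℝ (Fin m)}
    {S : Matrix (Fin m) (Fin m) ℝ} (h : GHParam ν μ α a S) :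
    GIGParam ν μ (√(α ^ 2 - inner ℝ a (Matrix.toEuclideanCLM (𝕜 := ℝ) S a))) := by
  obtain ⟨-, h1, h2, h3⟩ := h
  exact ⟨fun hν => ⟨(h1 hν).1, Real.sqrt_nonneg _⟩,
    fun hν => ⟨(h2 hν).1, Real.sqrt_pos.2 (sub_pos.2 (h2 hν).2)⟩,
    fun hν => ⟨(h3 hν).1, Real.sqrt_pos.2 (sub_pos.2 (h3 hν).2)⟩⟩

/-- The generalized hyperbolic law
`GH_{ν, μ, α, a, b, S} = ∫ N_{b + z S a, z S} GIG_{ν, μ, √(α² - ⟨a, S a⟩)}(dz)`. -/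
noncomputable def GH (ν μ α : ℝ) (a b : EuclideanSpace ℝ (Fin m))
    (S : Matrix (Fin m) (Fin m) ℝ) (hS : S.PosDef) (h : GHParam ν μ α a S) :
    ProbabilityMeasure (EuclideanSpace ℝ (Fin m)) :=
  ⟨normalMixture (Matrix.toEuclideanCLM (𝕜 := ℝ) S a) b S
      (GIG ν μ (√(α ^ 2 - inner ℝ a (Matrix.toEuclideanCLM (𝕜 := ℝ) S a))) h.gigParam : Measure ℝ),
    isProbabilityMeasure_normalMixture hS _ _ (ae_nonneg_gigMeasure _ _ _)⟩

/-- With first vector parameter `S⁻¹ a`, the quantity `⟨S⁻¹ a, S S⁻¹ a⟩` is `⟨a, S⁻¹ a⟩`, and the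
parameters `-ν, √(α² - ⟨a, S⁻¹ a⟩), μ` of the reciprocal mixing law are admissible. -/
theorem GHParam.gigParam_neg {ν μ α : ℝ} {a : EuclideanSpace ℝ (Fin m)}
    {S : Matrix (Fin m) (Fin m) ℝ} (hS : S.PosDef)
    (h : GHParam ν μ α (Matrix.toEuclideanCLM (𝕜 := ℝ) S⁻¹ a) S) :
    GIGParam (-ν) (√(α ^ 2 - inner ℝ a (Matrix.toEuclideanCLM (𝕜 := ℝ) S⁻¹ a))) μ := by
  have h1 := h.gigParam.neg
  have hdet : IsUnit S.det := (Matrix.isUnit_iff_isUnit_det _).1 hS.isUnit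
  have h2 : Matrix.toEuclideanCLM (𝕜 := ℝ) S (Matrix.toEuclideanCLM (𝕜 := ℝ) S⁻¹ a) = a := by
    rw [← mul_apply_eq_comp, ← map_mul, Matrix.mul_nonsing_inv _ hdet, map_one]
    rfl
  rwa [h2, real_inner_comm] at h1

end Mixture

/-! ### Weak relative compactness and statistics from samples of random size -/

/-- A family of real random variables is weakly relatively compact if each sequence of its
elements contains a weakly convergent subsequence. -/
def WeaklyRelativelyCompact {Ω : Type*} [MeasurableSpace Ω] (P : Measure Ω)
    [IsProbabilityMeasure P] (U : ℕ → Ω → ℝ) : Prop :=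
  ∀ j : ℕ → ℕ, ∃ φ : ℕ → ℕ, StrictMono φ ∧ ∃ L : ProbabilityMeasure ℝ,
    TendstoInDistribution (fun i => U (j (φ i))) atTop id (fun _ => P) (L : Measure ℝ)

/-- The random vector `T_k(X_1, …, X_k)`; the observation `X_j` is `X (j - 1)` here. -/
def statistic {Ω E F : Type*} (T : (k : ℕ) → (Fin k → E) → F) (X : ℕ → Ω → E) (k : ℕ) (ω : Ω) : F :=
  T k fun i => X i ω

/-- The statistic `ω ↦ T_{N(ω)}(X_1(ω), …, X_{N(ω)}(ω))` of a sample with random size `N`. -/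
def randomSizeStatistic {Ω E F : Type*} (T : (k : ℕ) → (Fin k → E) → F) (X : ℕ → Ω → E)
    (N : Ω → ℕ) (ω : Ω) : F :=
  statistic T X (N ω) ω

/-- The characteristic function `h_{n,k}` of
`Y_{n,k} = σ_n √k (T_{n,k} - θ_n) - √(n / k) a_n`. -/
noncomputable def normalizedCharFun {Ω E : Type*} [MeasurableSpace Ω] {m : ℕ} (P : Measure Ω)
    (T : ℕ → (k : ℕ) → (Fin k → E) → EuclideanSpace ℝ (Fin m)) (X : ℕ → ℕ → Ω → E)
    (θ a : ℕ → EuclideanSpace ℝ (Fin m)) (σ : ℕ → ℝ) (n k : ℕ) :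
    EuclideanSpace ℝ (Fin m) → ℂ :=
  charFun (P.map fun ω =>
    (σ n * √(k : ℝ)) • (statistic (T n) (X n) k ω - θ n) - √((n : ℝ) / k) • a n)

/-! Put `U = n / N`. Since `σ √n (T_k - θ)` equals `√(n/k) Y_{n,k} + (n/k) a_n`, splitting over the
values of `N` and using independence gives the characteristic function of the randomly indexed
statistic as `exp(-i⟨t, b_n⟩) E[exp(i U ⟨t, a_n⟩) h_{n,N}(√U t)]` (`charFun_randomSizeStatistic`).
On `{U < K}` the points `√U t` stay in a fixed ball, so `hnormal` replaces `h` by the Gaussian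
exponential; tightness of `U` controls the rest. What remains is `exp(-i⟨t, b⟩) E exp(z_t U)` with
`z_t = i⟨t, a⟩ - ⟨t, S t⟩ / 2`. Hence whenever `U` converges in law to `L` along a subsequence, the
characteristic functions converge to that of the normal mixture with mixing law `L`
(`tendsto_charFun_randomSizeStatistic`).

This proves one direction, because inversion carries `GIG_{-ν, lam, μ}` to `GIG_{ν, μ, lam}` and is
continuous off the null set `{0}`. For the converse, relative compactness supplies subsequential
limits `L` of `U`, each with the same mixture as the GIG law. Mixing laws are identifiable: along a
ray of `t`, `z_t` traces a parabola in the left half-plane, where the Laplace transform is analytic,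
so the identity theorem applies (`ext_of_complexMGF_eq_on_parabola`). -/

/-- **Mapping theorem** for weak convergence, for a measurable map which is almost everywhere
continuous with respect to the limit law. -/
theorem tendsto_map_of_ae_continuousAt {E F ι : Type*} [MeasurableSpace E] [TopologicalSpace E]
    [OpensMeasurableSpace E] [HasOuterApproxClosed E] [MeasurableSpace F] [TopologicalSpace F]
    [BorelSpace F] [HasOuterApproxClosed F] {l : Filter ι} [l.IsCountablyGenerated]
    {μs : ι → ProbabilityMeasure E} {μ : ProbabilityMeasure E} (h : Tendsto μs l (𝓝 μ))
    {g : E → F} (hg : Measurable g) (hc : ∀ᵐ x ∂(μ : Measure E), ContinuousAt g x) :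
    Tendsto (fun i => (μs i).map hg.aemeasurable) l (𝓝 (μ.map hg.aemeasurable)) := by
  refine tendsto_of_forall_isClosed_limsup_le' fun K hK => ?_
  simp only [ProbabilityMeasure.toMeasure_map, Measure.map_apply hg hK.measurableSet]
  -- A point of the closure of `g ⁻¹' K` at which `g` is continuous already lies in `g ⁻¹' K`, so
  -- taking the closure adds only a null set.
  have h1 : (μ : Measure E) (closure (g ⁻¹' K)) ≤ (μ : Measure E) (g ⁻¹' K) := by
    refine measure_mono_ae ?_
    filter_upwards [hc] with x hx hxK
    have := hx.continuousWithinAt.mem_closure_image hxK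
    exact hK.closure_subset (closure_mono (image_preimage_subset g K) this)
  calc limsup (fun i => (μs i : Measure E) (g ⁻¹' K)) l
      ≤ limsup (fun i => (μs i : Measure E) (closure (g ⁻¹' K))) l :=
        limsup_le_limsup (Eventually.of_forall fun i => measure_mono subset_closure)
    _ ≤ (μ : Measure E) (closure (g ⁻¹' K)) :=
        ProbabilityMeasure.limsup_measure_closed_le_of_tendsto h isClosed_closure
    _ ≤ _ := h1

/-! ### Reciprocals of generalized inverse Gaussian variables -/

theorem ae_pos_gigMeasure (ν μ lam : ℝ) : ∀ᵐ z ∂(gigMeasure ν μ lam), 0 < z := by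
  refine (withDensity_absolutelyContinuous _ _).ae_le ?_
  filter_upwards [ae_restrict_mem measurableSet_Ioi] with x hx
  exact hx

theorem image_inv_Ioi_zero : (fun x : ℝ => x⁻¹) '' Ioi 0 = Ioi 0 := by
  rw [Set.image_inv_eq_inv]
  ext x
  simp

/-- The factor `(x ^ 2)⁻¹` is the Jacobian of inversion: it turns the power `ν + 1` into `ν - 1`,
while inversion swaps the two terms of the exponent. -/
theorem inv_sq_mul_gigKernel_inv {ν μ lam x : ℝ} (hx : 0 < x) :
    (x ^ 2)⁻¹ * gigKernel (-ν) lam μ x⁻¹ = gigKernel ν μ lam x := by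
  have e : (x ^ 2)⁻¹ = x ^ (-2 : ℝ) := by
    rw [Real.rpow_neg hx.le]
    norm_num
  rw [gigKernel, gigKernel, Real.inv_rpow hx.le, ← Real.rpow_neg hx.le, e, ← mul_assoc,
    ← Real.rpow_add hx]
  congr 1
  · congr 1
    ring
  · congr 1
    field_simp
    ring

/-- Substitution of `x⁻¹`. Admissibility is not needed, since the change of variables formula also
covers divergent integrals. -/
theorem gigNorm_neg (ν μ lam : ℝ) : gigNorm (-ν) lam μ = gigNorm ν μ lam := by
  have h := integral_image_eq_integral_abs_deriv_smul (f := fun x : ℝ => x⁻¹)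
    (f' := fun x => -(x ^ 2)⁻¹) measurableSet_Ioi
    (fun x hx => (hasDerivAt_inv (ne_of_gt hx)).hasDerivWithinAt) inv_injective.injOn
    (gigKernel (-ν) lam μ)
  rw [image_inv_Ioi_zero] at h
  rw [gigNorm, h, gigNorm]
  refine setIntegral_congr_fun measurableSet_Ioi fun x hx => ?_
  have hx' : (0 : ℝ) < x := hx
  simp only [smul_eq_mul]
  rw [abs_neg, abs_of_pos (by positivity), inv_sq_mul_gigKernel_inv hx']

/-- The reciprocal of a random variable with law `GIG_{ν, μ, lam}` has law `GIG_{-ν, lam, μ}`. -/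
theorem map_inv_gigMeasure (ν μ lam : ℝ) :
    (gigMeasure ν μ lam).map (fun x => x⁻¹) = gigMeasure (-ν) lam μ := by
  refine Measure.ext_of_lintegral _ fun f hf => ?_
  have hd : ∀ ν μ lam : ℝ, Measurable
      fun x => ENNReal.ofReal (gigKernel ν μ lam x / gigNorm ν μ lam) := fun ν μ lam =>
    ((measurable_gigKernel ν μ lam).div_const _).ennreal_ofReal
  rw [lintegral_map hf measurable_inv, gigMeasure, gigMeasure,
    lintegral_withDensity_eq_lintegral_mul _ (hd _ _ _) (by fun_prop),
    lintegral_withDensity_eq_lintegral_mul _ (hd _ _ _) hf]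
  have h := lintegral_image_eq_lintegral_abs_deriv_mul (f := fun x : ℝ => x⁻¹)
    (f' := fun x => -(x ^ 2)⁻¹) measurableSet_Ioi
    (fun x hx => (hasDerivAt_inv (ne_of_gt hx)).hasDerivWithinAt) inv_injective.injOn
    ((fun x => ENNReal.ofReal (gigKernel (-ν) lam μ x / gigNorm (-ν) lam μ)) * f)
  rw [image_inv_Ioi_zero] at h
  rw [h]
  refine setLIntegral_congr_fun measurableSet_Ioi fun x hx => ?_
  have hx' : (0 : ℝ) < x := hx
  simp only [Pi.mul_apply]
  rw [← mul_assoc, ← ENNReal.ofReal_mul (abs_nonneg _), abs_neg, abs_of_pos (by positivity),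
    gigNorm_neg, ← mul_div_assoc, inv_sq_mul_gigKernel_inv hx']

/-! ### Characteristic functions of normal mixtures -/

/-- Realizes the mixture as the law of `b + Z a + √Z Y` with `Z` and `Y` independent, which makes
Fubini available. -/
theorem normalMixture_eq_map {m : ℕ} {S : Matrix (Fin m) (Fin m) ℝ} (hS : S.PosDef)
    (a b : EuclideanSpace ℝ (Fin m)) {G : Measure ℝ} [SFinite G] (hG : ∀ᵐ z ∂G, 0 ≤ z) :
    normalMixture a b S G =
      (G.prod (multivariateGaussian 0 S)).map fun p => (b + p.1 • a) + √p.1 • p.2 := by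
  have hf : Measurable (fun p : ℝ × EuclideanSpace ℝ (Fin m) => (b + p.1 • a) + √p.1 • p.2) := by
    fun_prop
  ext s hs
  rw [normalMixture, Measure.bind_apply hs (aemeasurable_mixtureKernel hS a b hG),
    Measure.map_apply hf hs, Measure.prod_apply (hf hs)]
  refine lintegral_congr_ae ?_
  filter_upwards [hG] with z hz
  rw [multivariateGaussian_smul hS hz, Measure.map_apply (by fun_prop) hs]
  rfl

/-- Given `Z = z` the law is Gaussian with log-characteristic function affine in `z`, so integrating
over `z` gives the Laplace transform of `G` at a complex point. -/
theorem charFun_normalMixture {m : ℕ} {S : Matrix (Fin m) (Fin m) ℝ} (hS : S.PosDef)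
    (a b : EuclideanSpace ℝ (Fin m)) {G : Measure ℝ} [IsProbabilityMeasure G]
    (hG : ∀ᵐ z ∂G, 0 ≤ z) (t : EuclideanSpace ℝ (Fin m)) :
    charFun (normalMixture a b S G) t =
      Complex.exp (inner ℝ t b * Complex.I) * ∫ z, Complex.exp (z * (inner ℝ t a * Complex.I -
        (inner ℝ t (Matrix.toEuclideanCLM (𝕜 := ℝ) S t) : ℝ) / 2)) ∂G := by
  have hf : Measurable (fun p : ℝ × EuclideanSpace ℝ (Fin m) => (b + p.1 • a) + √p.1 • p.2) := by
    fun_prop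
  rw [normalMixture_eq_map hS a b hG, charFun_apply, integral_map hf.aemeasurable (by fun_prop),
    integral_prod]
  · rw [← integral_const_mul]
    refine integral_congr_ae ?_
    filter_upwards [hG] with z hz
    have h1 : ∫ y, Complex.exp (inner ℝ ((b + z • a) + √z • y) t * Complex.I)
        ∂(multivariateGaussian 0 S) = charFun (multivariateGaussian (b + z • a) (z • S)) t := by
      rw [multivariateGaussian_smul hS hz, charFun_apply,
        integral_map (by fun_prop) (by fun_prop)]
    rw [h1, charFun_multivariateGaussian (hS.posSemidef.smul hz), ← Complex.exp_add]
    congr 1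
    have h2 : inner ℝ t (Matrix.toEuclideanCLM (𝕜 := ℝ) S t) = t.ofLp ⬝ᵥ S.mulVec t.ofLp := by
      rw [EuclideanSpace.inner_eq_star_dotProduct]
      simp [dotProduct_comm]
    rw [h2, inner_add_right, real_inner_smul_right]
    simp only [Matrix.smul_mulVec, dotProduct_smul, smul_eq_mul]
    push_cast
    ring
  · refine Integrable.of_bound (C := 1) (Measurable.aestronglyMeasurable (by fun_prop)) ?_
    refine Eventually.of_forall fun p => ?_
    rw [Complex.norm_exp_ofReal_mul_I]

/-! ### Uniqueness of the Laplace transform on a curve -/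

theorem norm_cexp_mul_ofReal_le_one {z : ℂ} (hz : z.re ≤ 0) {x : ℝ} (hx : 0 ≤ x) :
    ‖Complex.exp (z * x)‖ ≤ 1 := by
  rw [Complex.norm_exp, Complex.re_mul_ofReal, Real.exp_le_one_iff]
  exact mul_nonpos_of_nonpos_of_nonneg hz hx

theorem Iio_zero_subset_interior_integrableExpSet {L : Measure ℝ} [IsProbabilityMeasure L]
    (hL : ∀ᵐ x ∂L, 0 ≤ x) : Iio 0 ⊆ interior (integrableExpSet id L) := by
  refine interior_maximal (fun x hx => ?_) isOpen_Iio
  refine Integrable.of_bound (C := 1) (Measurable.aestronglyMeasurable (by fun_prop)) ?_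
  filter_upwards [hL] with y hy
  rw [Real.norm_of_nonneg (Real.exp_pos _).le, Real.exp_le_one_iff]
  exact mul_nonpos_of_nonpos_of_nonneg (le_of_lt hx) hy

/-- The imaginary axis may lie on the boundary of the domain of analyticity; dominated convergence
with bound `1` reaches it from the open left half-plane. -/
theorem tendsto_complexMGF_charFun {L : Measure ℝ} [IsProbabilityMeasure L]
    (hL : ∀ᵐ x ∂L, 0 ≤ x) (t : ℝ) :
    Tendsto (fun n : ℕ => complexMGF id L (-(1 / ((n : ℝ) + 1) : ℝ) + t * Complex.I)) atTop
      (𝓝 (charFun L t)) := by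
  rw [charFun_apply]
  refine tendsto_integral_of_dominated_convergence (fun _ => 1)
    (fun n => Measurable.aestronglyMeasurable (by fun_prop)) (integrable_const _) ?_ ?_
  · intro n
    filter_upwards [hL] with x hx
    refine norm_cexp_mul_ofReal_le_one ?_ hx
    have : (0 : ℝ) ≤ 1 / ((n : ℝ) + 1) := by positivity
    generalize 1 / ((n : ℝ) + 1) = e at this
    simpa using this
  · refine Eventually.of_forall fun x => ?_
    have h0 : Tendsto (fun n : ℕ => (1 / ((n : ℝ) + 1) : ℝ)) atTop (𝓝 0) :=
      tendsto_one_div_add_atTop_nhds_zero_nat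
    have hc : Continuous fun e : ℝ => Complex.exp ((-(e : ℂ) + t * Complex.I) * (x : ℂ)) := by
      fun_prop
    have h1 := (hc.tendsto 0).comp h0
    have e : Complex.exp (inner ℝ x t * Complex.I) =
        Complex.exp ((-((0 : ℝ) : ℂ) + t * Complex.I) * (x : ℂ)) := by
      simp only [Complex.ofReal_zero, neg_zero, zero_add, RCLike.inner_apply, conj_trivial]
      push_cast
      congr 1
      ring
    rw [e]
    exact h1

/-- A law on `[0, ∞)` is determined by its Laplace transform along the curve
`s ↦ -s² q / 2 + i s p`, where `q > 0`. -/
theorem ext_of_complexMGF_eq_on_parabola {L L' : Measure ℝ} [IsProbabilityMeasure L]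
    [IsProbabilityMeasure L'] (hL : ∀ᵐ x ∂L, 0 ≤ x) (hL' : ∀ᵐ x ∂L', 0 ≤ x) {p q : ℝ}
    (hq : 0 < q)
    (h : ∀ s : ℝ, complexMGF id L ((s * p : ℝ) * Complex.I - (s ^ 2 * q / 2 : ℝ)) =
      complexMGF id L' ((s * p : ℝ) * Complex.I - (s ^ 2 * q / 2 : ℝ))) : L = L' := by
  set c : ℝ → ℂ := fun s => (s * p : ℝ) * Complex.I - (s ^ 2 * q / 2 : ℝ) with hc
  have hre : ∀ s, (c s).re = -(s ^ 2 * q / 2) := fun s => by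
    simp only [hc, Complex.sub_re, Complex.re_ofReal_mul, Complex.I_re, Complex.ofReal_re]
    ring
  have hcc : Continuous c := by fun_prop
  set H : Set ℂ := {z | z.re < 0} with hH
  have hpre : IsPreconnected H := (convex_halfSpace_re_lt 0).isPreconnected
  have han : ∀ (M : Measure ℝ) [IsProbabilityMeasure M], (∀ᵐ x ∂M, 0 ≤ x) →
      AnalyticOnNhd ℂ (complexMGF id M) H := fun M _ hM z hz =>
    analyticAt_complexMGF (Iio_zero_subset_interior_integrableExpSet hM hz)
  have h1 : c 1 ∈ H := by
    simp only [hH, mem_ofPred_eq, hre]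
    linarith
  -- The identity theorem needs an accumulation point inside the half-plane. Near `s = 1` the real
  -- part `-s² q / 2` is injective, so `c s` approaches `c 1` without attaining it for `s ≠ 1`.
  have htend : Tendsto c (𝓝[≠] 1) (𝓝[≠] (c 1)) := by
    refine tendsto_nhdsWithin_iff.2 ⟨hcc.continuousAt.tendsto.mono_left nhdsWithin_le_nhds, ?_⟩
    filter_upwards [self_mem_nhdsWithin, nhdsWithin_le_nhds (lt_mem_nhds (zero_lt_one' ℝ))]
      with s hs1 hs0 hs
    have h2 := congrArg Complex.re hs
    rw [hre, hre] at h2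
    have h3 : (s - 1) * ((s + 1) * q) = 0 := by linarith
    rcases mul_eq_zero.1 h3 with h4 | h4
    · exact hs1 (sub_eq_zero.1 h4)
    · have : 0 < (s + 1) * q := by positivity
      exact this.ne' h4
  have heq := (han L hL).eqOn_of_preconnected_of_frequently_eq (han L' hL') hpre h1
    (htend.frequently (Eventually.of_forall h).frequently)
  refine Measure.ext_of_charFun (funext fun t => ?_)
  refine tendsto_nhds_unique (tendsto_complexMGF_charFun hL t) ?_
  refine (tendsto_complexMGF_charFun hL' t).congr fun n => (heq ?_).symm
  have : (0 : ℝ) < 1 / ((n : ℝ) + 1) := by positivity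
  generalize 1 / ((n : ℝ) + 1) = e at this
  simp only [hH, mem_ofPred_eq]
  simpa using this

/-! ### Expectations with a random index -/

section RandomIndex

variable {Ω : Type*} [MeasurableSpace Ω] {P : Measure Ω}

theorem integral_eq_tsum_fiber {N : Ω → ℕ} (hN : Measurable N) {f : Ω → ℂ}
    (hf : Integrable f P) : ∫ ω, f ω ∂P = ∑' k, ∫ ω in N ⁻¹' {k}, f ω ∂P := by
  have h := integral_iUnion (μ := P) (f := f) (s := fun k => N ⁻¹' {k})
    (fun k => hN (measurableSet_singleton k))
    (fun i j hij => Disjoint.preimage N (disjoint_singleton.2 hij)) hf.integrableOn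
  rwa [← preimage_iUnion, iUnion_of_singleton, preimage_univ, setIntegral_univ] at h

theorem measurable_randomIndex {F : Type*} [MeasurableSpace F] {N : Ω → ℕ} (hN : Measurable N)
    {W : ℕ → Ω → F} (hW : ∀ k, Measurable (W k)) : Measurable fun ω => W (N ω) ω :=
  (measurable_from_prod_countable_right (f := fun p : ℕ × Ω => W p.1 p.2) hW).comp
    (hN.prodMk measurable_id)

variable [IsProbabilityMeasure P]

/-- The expectation of a random member of a sequence, for an index which is independent of each
single member. -/
theorem integral_randomIndex {N : Ω → ℕ} (hN : Measurable N) {W : ℕ → Ω → ℂ}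
    (hW : ∀ k, Measurable (W k)) (hW1 : ∀ k ω, ‖W k ω‖ ≤ 1) (hpos : ∀ᵐ ω ∂P, 1 ≤ N ω)
    (hind : ∀ k, 1 ≤ k → IndepFun N (W k) P) :
    ∫ ω, W (N ω) ω ∂P = ∫ ω, (∫ ω', W (N ω) ω' ∂P) ∂P := by
  have hb : ∀ k, ‖∫ ω', W k ω' ∂P‖ ≤ 1 := fun k => by
    simpa using norm_integral_le_of_norm_le_const (μ := P) (Eventually.of_forall (hW1 k))
  rw [integral_eq_tsum_fiber hN, integral_eq_tsum_fiber hN]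
  · refine tsum_congr fun k => ?_
    have hs : MeasurableSet (N ⁻¹' {k}) := hN (measurableSet_singleton k)
    have h3 : ∫ ω in N ⁻¹' {k}, W (N ω) ω ∂P = ∫ ω in N ⁻¹' {k}, W k ω ∂P :=
      setIntegral_congr_fun hs fun ω hω => by rw [show N ω = k from hω]
    have h4 : ∫ ω in N ⁻¹' {k}, (∫ ω', W (N ω) ω' ∂P) ∂P =
        ∫ ω in N ⁻¹' {k}, (∫ ω', W k ω' ∂P) ∂P :=
      setIntegral_congr_fun hs fun ω hω => by simp only [show N ω = k from hω]
    rw [h3, h4]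
    rcases Nat.eq_zero_or_pos k with rfl | hk
    -- Independence is assumed only for `k ≥ 1`; the fibre over `0` is null.
    · have h0 : P (N ⁻¹' {0}) = 0 := by
        refine measure_mono_null (fun ω hω => ?_) hpos
        have : N ω = 0 := hω
        simp [this]
      rw [setIntegral_measure_zero _ h0, setIntegral_measure_zero _ h0]
    -- The indicator of `{N = k}` is a function of `N`, hence independent of `W k`, and the
    -- expectation of the product factors.
    · have hm : Measurable fun j : ℕ => (({k} : Set ℕ).indicator (fun _ => (1 : ℂ))) j :=
        Measurable.of_discrete
      have h1 := ((hind k hk).comp hm measurable_id).integral_fun_mul_eq_mul_integral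
        (hm.comp hN).aestronglyMeasurable (hW k).aestronglyMeasurable
      have h2 : ∀ g : Ω → ℂ, ∫ ω in N ⁻¹' {k}, g ω ∂P =
          ∫ ω, ({k} : Set ℕ).indicator (fun _ => (1 : ℂ)) (N ω) * g ω ∂P := fun g => by
        rw [← integral_indicator hs]
        refine integral_congr_ae (Eventually.of_forall fun ω => ?_)
        by_cases hω : N ω = k <;> simp [indicator, hω]
      rw [h2, h2, integral_mul_const]
      exact h1
  · refine Integrable.of_bound (C := 1) ?_ (Eventually.of_forall fun ω => hb _)
    exact ((Measurable.of_discrete (f := fun k => ∫ ω', W k ω' ∂P)).comp hN).aestronglyMeasurable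
  · exact Integrable.of_bound (C := 1) (measurable_randomIndex hN hW).aestronglyMeasurable
      (Eventually.of_forall fun ω => hW1 _ _)

end RandomIndex

/-! ### Characteristic functions for samples of random size -/

section RandomSize

variable {Ω E : Type*} [MeasurableSpace Ω] [MeasurableSpace E] {P : Measure Ω} {m : ℕ}
  {X : ℕ → ℕ → Ω → E} {T : ℕ → (k : ℕ) → (Fin k → E) → EuclideanSpace ℝ (Fin m)}
  {θ a : ℕ → EuclideanSpace ℝ (Fin m)} {σ : ℕ → ℝ} {n : ℕ}

theorem measurable_statistic {F : Type*} [MeasurableSpace F] {T : (k : ℕ) → (Fin k → E) → F}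
    {X : ℕ → Ω → E} (hT : ∀ k, Measurable (T k)) (hX : ∀ j, Measurable (X j)) (k : ℕ) :
    Measurable (statistic T X k) :=
  (hT k).comp (measurable_pi_lambda _ fun i => hX i)

variable [IsProbabilityMeasure P]

/-- The characteristic function of a normalized statistic of a sample with random size. -/
theorem charFun_randomSizeStatistic (hX : ∀ j, Measurable (X n j))
    (hT : ∀ k, Measurable (T n k)) {N : Ω → ℕ} (hN : Measurable N)
    (hNpos : ∀ᵐ ω ∂P, 1 ≤ N ω)
    (hNindep : ∀ k, 1 ≤ k → IndepFun N (fun ω => statistic (T n) (X n) k ω - θ n) P)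
    (b t : EuclideanSpace ℝ (Fin m)) :
    charFun (P.map fun ω => (σ n * √(n : ℝ)) • (randomSizeStatistic (T n) (X n) N ω - θ n) - b) t =
      Complex.exp (-(inner ℝ t b * Complex.I)) * ∫ ω,
        Complex.exp (((n : ℝ) / N ω * inner ℝ t (a n) : ℝ) * Complex.I) *
          normalizedCharFun P T X θ a σ n (N ω) (√((n : ℝ) / N ω) • t) ∂P := by
  have hst := measurable_statistic hT hX
  set V : EuclideanSpace ℝ (Fin m) → ℂ := fun y =>
    Complex.exp (inner ℝ ((σ n * √(n : ℝ)) • y) t * Complex.I) with hV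
  have hVm : Measurable V := by fun_prop
  have hV1 : ∀ y, ‖V y‖ ≤ 1 := fun y => (Complex.norm_exp_ofReal_mul_I _).le
  have hW : ∀ k, Measurable fun ω => V (statistic (T n) (X n) k ω - θ n) := fun k =>
    hVm.comp ((hst k).sub_const _)
  have hrs : Measurable (randomSizeStatistic (T n) (X n) N) := measurable_randomIndex hN hst
  rw [charFun_apply, integral_map (by fun_prop) (by fun_prop)]
  have h1 : ∀ ω, Complex.exp (inner ℝ
      ((σ n * √(n : ℝ)) • (randomSizeStatistic (T n) (X n) N ω - θ n) - b) t * Complex.I) =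
      Complex.exp (-(inner ℝ t b * Complex.I)) *
        V (statistic (T n) (X n) (N ω) ω - θ n) := fun ω => by
    rw [hV, ← Complex.exp_add, inner_sub_left, real_inner_comm t b]
    congr 1
    simp only [randomSizeStatistic]
    push_cast
    ring
  simp_rw [h1]
  rw [integral_const_mul, integral_randomIndex hN hW (fun k ω => hV1 _) hNpos
    fun k hk => (hNindep k hk).comp measurable_id hVm]
  congr 1
  refine integral_congr_ae ?_
  filter_upwards [hNpos] with ω hω
  have hk : (0 : ℝ) < N ω := by exact_mod_cast hω
  rw [normalizedCharFun, charFun_apply, integral_map (by fun_prop) (by fun_prop),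
    ← integral_const_mul]
  refine integral_congr_ae (Eventually.of_forall fun ω' => ?_)
  simp only [hV]
  rw [← Complex.exp_add]
  congr 1
  have hn : (0 : ℝ) ≤ (n : ℝ) / N ω := by positivity
  -- These two factorizations express `σ √n (T_k - θ)` as `√(n/k) Y_{n,k} + (n/k) a_n`.
  have e1 : √(n : ℝ) = √((n : ℝ) / N ω) * √(N ω : ℝ) := by
    rw [← Real.sqrt_mul hn, div_mul_cancel₀ _ hk.ne']
  have e2 : (n : ℝ) / N ω = √((n : ℝ) / N ω) * √((n : ℝ) / N ω) := (Real.mul_self_sqrt hn).symm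
  rw [← add_mul, ← Complex.ofReal_add]
  congr 2
  rw [inner_sub_left, real_inner_smul_right, real_inner_smul_right, real_inner_smul_left,
    real_inner_smul_left, real_inner_smul_left, real_inner_comm t (a n)]
  rw [e1]
  nth_rewrite 2 [e2]
  ring

theorem norm_normalizedCharFun_le_one (hX : ∀ j, Measurable (X n j))
    (hT : ∀ k, Measurable (T n k)) (k : ℕ) (t : EuclideanSpace ℝ (Fin m)) :
    ‖normalizedCharFun P T X θ a σ n k t‖ ≤ 1 := by
  have := measurable_statistic hT hX k
  have : IsProbabilityMeasure (P.map fun ω =>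
      (σ n * √(k : ℝ)) • (statistic (T n) (X n) k ω - θ n) - √((n : ℝ) / k) • a n) :=
    Measure.isProbabilityMeasure_map (by fun_prop)
  exact norm_charFun_le_one _

end RandomSize

/-! ### Consequences of convergence in distribution -/

theorem TendstoInDistribution.tendsto_toProbabilityMeasure {Ω E ι : Type*} [MeasurableSpace Ω]
    {P : Measure Ω} [IsProbabilityMeasure P] [MeasurableSpace E] [TopologicalSpace E]
    [OpensMeasurableSpace E] {l : Filter ι} {U : ι → Ω → E} {L : ProbabilityMeasure E}
    (h : TendstoInDistribution U l id (fun _ => P) (L : Measure E)) :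
    Tendsto (β := ProbabilityMeasure E) (fun i => (⟨P.map (U i), Measure.isProbabilityMeasure_map (h.forall_aemeasurable i)⟩ :
      ProbabilityMeasure E)) l (𝓝 L) := by
  have h1 := h.tendsto
  have e : (⟨(L : Measure E).map id, Measure.isProbabilityMeasure_map h.aemeasurable_limit⟩ :
      ProbabilityMeasure E) = L := Subtype.ext Measure.map_id
  rwa [e] at h1

theorem tendstoInDistribution_id_of_tendsto {Ω E ι : Type*} [MeasurableSpace Ω]
    {P : Measure Ω} [IsProbabilityMeasure P] [MeasurableSpace E] [TopologicalSpace E]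
    [OpensMeasurableSpace E] {l : Filter ι} {U : ι → Ω → E} {L : ProbabilityMeasure E}
    (hU : ∀ i, AEMeasurable (U i) P)
    (h : Tendsto (β := ProbabilityMeasure E) (fun i => (⟨P.map (U i), Measure.isProbabilityMeasure_map (hU i)⟩ :
      ProbabilityMeasure E)) l (𝓝 L)) :
    TendstoInDistribution U l id (fun _ => P) (L : Measure E) := by
  refine ⟨hU, aemeasurable_id, ?_⟩
  have e : (⟨(L : Measure E).map id, Measure.isProbabilityMeasure_map aemeasurable_id⟩ :
      ProbabilityMeasure E) = L := Subtype.ext Measure.map_id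
  rwa [e]

section Distribution

variable {Ω : Type*} [MeasurableSpace Ω] {P : Measure Ω} [IsProbabilityMeasure P]

/-- Inversion is discontinuous only at `0`, which the limit law does not charge, so the mapping
theorem applies. -/
theorem TendstoInDistribution.inv {ι : Type*} {l : Filter ι} [l.IsCountablyGenerated]
    {U : ι → Ω → ℝ} {L L' : ProbabilityMeasure ℝ}
    (h : TendstoInDistribution U l id (fun _ => P) (L : Measure ℝ))
    (hL : ∀ᵐ x ∂(L : Measure ℝ), x ≠ 0) (hL' : (L : Measure ℝ).map (fun x => x⁻¹) = L') :
    TendstoInDistribution (fun i ω => (U i ω)⁻¹) l id (fun _ => P) (L' : Measure ℝ) := by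
  have hm : Measurable fun x : ℝ => x⁻¹ := measurable_inv
  refine tendstoInDistribution_id_of_tendsto
    (fun i => hm.comp_aemeasurable (h.forall_aemeasurable i)) ?_
  have h1 := tendsto_map_of_ae_continuousAt (TendstoInDistribution.tendsto_toProbabilityMeasure h)
    hm (hL.mono fun x hx => continuousAt_inv₀ hx)
  have e : L.map hm.aemeasurable = L' := Subtype.ext hL'
  rw [e] at h1
  refine h1.congr fun i => Subtype.ext ?_
  exact AEMeasurable.map_map_of_aemeasurable hm.aemeasurable (h.forall_aemeasurable i)

theorem TendstoInDistribution.ae_nonneg {U : ℕ → Ω → ℝ} {L : ProbabilityMeasure ℝ}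
    (h : TendstoInDistribution U atTop id (fun _ => P) (L : Measure ℝ))
    (hU : ∀ i ω, 0 ≤ U i ω) : ∀ᵐ x ∂(L : Measure ℝ), 0 ≤ x := by
  have h1 := ProbabilityMeasure.le_liminf_measure_open_of_tendsto
    (TendstoInDistribution.tendsto_toProbabilityMeasure h) (isOpen_Iio (a := (0 : ℝ)))
  have h2 : ∀ i, (P.map (U i)) (Iio 0) = 0 := fun i => by
    rw [Measure.map_apply_of_aemeasurable (h.forall_aemeasurable i) measurableSet_Iio]
    have : U i ⁻¹' Iio 0 = ∅ := by
      ext ω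
      simpa using hU i ω
    rw [this, measure_empty]
  simp only [ProbabilityMeasure.coe_mk, h2, liminf_const, nonpos_iff_eq_zero] at h1
  rw [ae_iff]
  simp only [not_le]
  exact h1

theorem exists_measure_Ici_lt (L : Measure ℝ) [IsProbabilityMeasure L] {ε : ENNReal} (hε : 0 < ε) :
    ∃ K : ℕ, L (Ici (K : ℝ)) < ε := by
  have h := tendsto_measure_iInter_atTop (μ := L) (s := fun K : ℕ => Ici (K : ℝ))
    (fun K => measurableSet_Ici.nullMeasurableSet)
    (fun i j hij => Ici_subset_Ici.2 (by exact_mod_cast hij)) ⟨0, measure_ne_top _ _⟩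
  have e : ⋂ K : ℕ, Ici (K : ℝ) = ∅ := by
    refine eq_empty_of_forall_notMem fun x hx => ?_
    obtain ⟨K, hK⟩ := exists_nat_gt x
    exact absurd (mem_iInter.1 hx K) (not_le.2 hK)
  rw [e, measure_empty] at h
  exact (h.eventually (gt_mem_nhds hε)).exists

/-- A sequence that converges in distribution is tight. -/
theorem TendstoInDistribution.exists_eventually_measureReal_lt {U : ℕ → Ω → ℝ}
    {L : ProbabilityMeasure ℝ}
    (h : TendstoInDistribution U atTop id (fun _ => P) (L : Measure ℝ)) {ε : ℝ} (hε : 0 < ε) :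
    ∃ K : ℕ, ∀ᶠ i in atTop, P.real {ω | (K : ℝ) ≤ U i ω} < ε := by
  obtain ⟨K, hK⟩ := exists_measure_Ici_lt (L : Measure ℝ) (ENNReal.ofReal_pos.2 hε)
  refine ⟨K, ?_⟩
  have h1 := ProbabilityMeasure.limsup_measure_closed_le_of_tendsto
    (TendstoInDistribution.tendsto_toProbabilityMeasure h) (isClosed_Ici (a := (K : ℝ)))
  filter_upwards [eventually_lt_of_limsup_lt (h1.trans_lt hK)] with i hi
  rw [ProbabilityMeasure.coe_mk,
    Measure.map_apply_of_aemeasurable (h.forall_aemeasurable i) measurableSet_Ici] at hi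
  rw [measureReal_def]
  exact (ENNReal.lt_ofReal_iff_toReal_lt (measure_ne_top _ _)).1 hi

/-- The function `exp (z x)` may be unbounded for `x < 0`. Replacing `x` by `max x 0` gives a
bounded continuous test function and changes nothing, as all the laws live on `[0, ∞)`. -/
theorem TendstoInDistribution.tendsto_integral_of_nonneg {U : ℕ → Ω → ℝ}
    {L : ProbabilityMeasure ℝ}
    (h : TendstoInDistribution U atTop id (fun _ => P) (L : Measure ℝ))
    (hU : ∀ i ω, 0 ≤ U i ω) {z : ℂ} (hz : z.re ≤ 0) :
    Tendsto (fun i => ∫ ω, Complex.exp (z * U i ω) ∂P) atTop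
      (𝓝 (complexMGF id (L : Measure ℝ) z)) := by
  have h1 := (ProbabilityMeasure.tendsto_iff_forall_integral_rclike_tendsto ℂ).1
    (TendstoInDistribution.tendsto_toProbabilityMeasure h)
  have hc : Continuous fun x : ℝ => Complex.exp (z * (max x 0 : ℝ)) := by fun_prop
  have h2 := h1 (BoundedContinuousFunction.ofNormedAddCommGroup _ hc 1
    fun x => norm_cexp_mul_ofReal_le_one hz (le_max_right _ _))
  simp only [ProbabilityMeasure.coe_mk, BoundedContinuousFunction.coe_ofNormedAddCommGroup] at h2
  have e1 : ∫ x : ℝ, Complex.exp (z * (max x 0 : ℝ)) ∂(L : Measure ℝ) =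
      complexMGF id (L : Measure ℝ) z := by
    refine integral_congr_ae ?_
    filter_upwards [TendstoInDistribution.ae_nonneg h hU] with x hx
    rw [max_eq_left hx]
    rfl
  rw [e1] at h2
  refine h2.congr fun i => ?_
  rw [integral_map (h.forall_aemeasurable i) hc.aestronglyMeasurable]
  simp_rw [max_eq_left (hU i _)]

end Distribution

/-! ### Replacing the characteristic functions by their Gaussian limit -/

section GaussianComparison

variable {m : ℕ}

theorem norm_cexp_mul_I_sub_le (x y : ℝ) :
    ‖Complex.exp (x * Complex.I) - Complex.exp (y * Complex.I)‖ ≤ |x - y| := by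
  have h := Real.norm_exp_I_mul_ofReal_sub_one_le (x := x - y)
  have e : Complex.exp (x * Complex.I) - Complex.exp (y * Complex.I) =
      Complex.exp (y * Complex.I) * (Complex.exp (Complex.I * (x - y : ℝ)) - 1) := by
    rw [mul_sub, ← Complex.exp_add, mul_one]
    congr 2
    push_cast
    ring
  rw [e, norm_mul, Complex.norm_exp_ofReal_mul_I, one_mul]
  simpa using h

theorem inner_toEuclideanCLM_nonneg {S : Matrix (Fin m) (Fin m) ℝ} (hS : S.PosSemidef)
    (t : EuclideanSpace ℝ (Fin m)) : 0 ≤ inner ℝ t (Matrix.toEuclideanCLM (𝕜 := ℝ) S t) := by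
  have := hS.dotProduct_mulVec_nonneg t.ofLp
  rw [EuclideanSpace.inner_eq_star_dotProduct]
  simpa [dotProduct_comm] using this

theorem norm_gaussianCharFun_le_one {S : Matrix (Fin m) (Fin m) ℝ} (hS : S.PosSemidef)
    (t : EuclideanSpace ℝ (Fin m)) :
    ‖((Real.exp (-(1 / 2) * inner ℝ t (Matrix.toEuclideanCLM (𝕜 := ℝ) S t)) : ℝ) : ℂ)‖ ≤ 1 := by
  rw [Complex.norm_real, Real.norm_of_nonneg (Real.exp_pos _).le, Real.exp_le_one_iff]
  have := inner_toEuclideanCLM_nonneg hS t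
  linarith

/-- Comparison of the characteristic functions of a normalized statistic and of its Gaussian limit,
after rescaling by `u`: a uniform distance on a ball, a drift error, and a tail term. -/
theorem norm_cexp_mul_sub_cexp_mul_le {h : EuclideanSpace ℝ (Fin m) → ℂ} (hh : ∀ t, ‖h t‖ ≤ 1)
    {S : Matrix (Fin m) (Fin m) ℝ} (hS : S.PosSemidef) (t : EuclideanSpace ℝ (Fin m))
    {u K x y : ℝ} (hu : 0 ≤ u) :
    ‖Complex.exp ((u * x : ℝ) * Complex.I) * h (√u • t) -
      Complex.exp ((y * Complex.I -
        (inner ℝ t (Matrix.toEuclideanCLM (𝕜 := ℝ) S t) : ℝ) / 2) * u)‖ ≤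
      (⨆ s : Metric.closedBall (0 : EuclideanSpace ℝ (Fin m)) (√K * ‖t‖ + 1), ‖h s -
        (Real.exp (-(1 / 2) * inner ℝ (s : EuclideanSpace ℝ (Fin m))
          (Matrix.toEuclideanCLM (𝕜 := ℝ) S s)) : ℂ)‖) + |K| * |x - y| +
        2 * {v : ℝ | K ≤ v}.indicator (fun _ => 1) u := by
  have hg := norm_gaussianCharFun_le_one hS
  have hd : ∀ s, ‖h s - ((Real.exp (-(1 / 2) *
      inner ℝ s (Matrix.toEuclideanCLM (𝕜 := ℝ) S s)) : ℝ) : ℂ)‖ ≤ 2 := fun s => by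
    refine (norm_sub_le _ _).trans ?_
    have h1 := hh s
    have h2 := hg s
    linarith
  have hsup : 0 ≤ ⨆ s : Metric.closedBall (0 : EuclideanSpace ℝ (Fin m)) (√K * ‖t‖ + 1), ‖h s -
        (Real.exp (-(1 / 2) * inner ℝ (s : EuclideanSpace ℝ (Fin m))
          (Matrix.toEuclideanCLM (𝕜 := ℝ) S s)) : ℂ)‖ := Real.iSup_nonneg fun s => norm_nonneg _
  have hexp : Complex.exp ((y * Complex.I -
      (inner ℝ t (Matrix.toEuclideanCLM (𝕜 := ℝ) S t) : ℝ) / 2) * u) =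
      Complex.exp ((u * y : ℝ) * Complex.I) * ((Real.exp (-(1 / 2) *
        inner ℝ (√u • t) (Matrix.toEuclideanCLM (𝕜 := ℝ) S (√u • t))) : ℝ) : ℂ) := by
    rw [Complex.ofReal_exp, ← Complex.exp_add, map_smul, real_inner_smul_left,
      real_inner_smul_right, ← mul_assoc (√u), Real.mul_self_sqrt hu]
    congr 1
    push_cast
    ring
  have hp : 0 ≤ |K| * |x - y| := by positivity
  rw [hexp]
  set g := ((Real.exp (-(1 / 2) *
        inner ℝ (√u • t) (Matrix.toEuclideanCLM (𝕜 := ℝ) S (√u • t))) : ℝ) : ℂ) with hgdef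
  -- For `u ≥ K` the trivial bound `2` is the tail term. For `u < K` the difference splits into the
  -- error in `h` on a ball and the error in the drift.
  rcases le_or_gt K u with hK | hK
  · rw [indicator_of_mem (by exact hK)]
    have h1 : ‖Complex.exp ((u * x : ℝ) * Complex.I) * h (√u • t) -
        Complex.exp ((u * y : ℝ) * Complex.I) * g‖ ≤ 1 + 1 := by
      refine (norm_sub_le _ _).trans (add_le_add ?_ ?_)
      · rw [norm_mul, Complex.norm_exp_ofReal_mul_I, one_mul]
        exact hh _
      · rw [norm_mul, Complex.norm_exp_ofReal_mul_I, one_mul]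
        exact hg _
    linarith
  · rw [indicator_of_notMem (by exact not_le.2 hK), mul_zero, add_zero]
    have e : Complex.exp ((u * x : ℝ) * Complex.I) * h (√u • t) -
        Complex.exp ((u * y : ℝ) * Complex.I) * g =
        Complex.exp ((u * x : ℝ) * Complex.I) * (h (√u • t) - g) +
        (Complex.exp ((u * x : ℝ) * Complex.I) - Complex.exp ((u * y : ℝ) * Complex.I)) * g := by
      ring
    rw [e]
    refine (norm_add_le _ _).trans (add_le_add ?_ ?_)
    · rw [norm_mul, Complex.norm_exp_ofReal_mul_I, one_mul]
      -- Radius `√K * ‖t‖` would suffice here; the `+ 1` keeps the radius positive when `t = 0` or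
      -- `K = 0`, as the normality hypothesis requires.
      have hmem : √u • t ∈ Metric.closedBall (0 : EuclideanSpace ℝ (Fin m)) (√K * ‖t‖ + 1) := by
        rw [mem_closedBall_zero_iff, norm_smul, Real.norm_of_nonneg (Real.sqrt_nonneg _)]
        have := mul_le_mul_of_nonneg_right (Real.sqrt_le_sqrt hK.le) (norm_nonneg t)
        linarith
      exact le_ciSup (f := fun s : Metric.closedBall (0 : EuclideanSpace ℝ (Fin m))
        (√K * ‖t‖ + 1) => ‖h s - (Real.exp (-(1 / 2) * inner ℝ (s : EuclideanSpace ℝ (Fin m))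
          (Matrix.toEuclideanCLM (𝕜 := ℝ) S s)) : ℂ)‖)
        ⟨2, by rintro _ ⟨s, rfl⟩; exact hd s⟩ ⟨_, hmem⟩
    · rw [norm_mul]
      refine (mul_le_of_le_one_right (norm_nonneg _) (hg _)).trans
        ((norm_cexp_mul_I_sub_le _ _).trans ?_)
      rw [← mul_sub, abs_mul]
      refine mul_le_mul_of_nonneg_right ?_ (abs_nonneg _)
      exact abs_le_abs_of_nonneg hu hK.le

end GaussianComparison

/-! ### Limits along subsequences -/

section Limit

variable {Ω E : Type*} [MeasurableSpace Ω] [MeasurableSpace E] {P : Measure Ω}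
  [IsProbabilityMeasure P] {m : ℕ}
  {X : ℕ → ℕ → Ω → E} {T : ℕ → (k : ℕ) → (Fin k → E) → EuclideanSpace ℝ (Fin m)}
  {θ aseq bseq : ℕ → EuclideanSpace ℝ (Fin m)} {σ : ℕ → ℝ} {N : ℕ → Ω → ℕ}
  {a b : EuclideanSpace ℝ (Fin m)} {S : Matrix (Fin m) (Fin m) ℝ}

/-- If the reciprocal relative sample sizes converge in distribution along a subsequence, then the
characteristic functions of the statistics of samples with random sizes converge along it. -/
theorem tendsto_charFun_randomSizeStatistic
    (hX : ∀ n j, Measurable (X n j)) (hT : ∀ n k, Measurable (T n k))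
    (hN : ∀ n, Measurable (N n)) (hNpos : ∀ n, 1 ≤ n → ∀ᵐ ω ∂P, 1 ≤ N n ω)
    (hNindep : ∀ n k, 1 ≤ n → 1 ≤ k →
      IndepFun (N n) (fun ω => statistic (T n) (X n) k ω - θ n) P)
    (ha : Tendsto aseq atTop (𝓝 a)) (hb : Tendsto bseq atTop (𝓝 b)) (hS : S.PosDef)
    (hnormal : ∀ R : ℝ, 0 < R → Tendsto (fun n : ℕ =>
        ∫ ω, (⨆ t : Metric.closedBall (0 : EuclideanSpace ℝ (Fin m)) R,
          ‖normalizedCharFun P T X θ aseq σ n (N n ω) t -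
            (Real.exp (-(1 / 2) *
              inner ℝ (t : EuclideanSpace ℝ (Fin m)) (Matrix.toEuclideanCLM (𝕜 := ℝ) S t)) : ℂ)‖) ∂P)
      atTop (𝓝 0))
    {j : ℕ → ℕ} (hj : Tendsto j atTop atTop) {L : ProbabilityMeasure ℝ}
    (hL : TendstoInDistribution (fun i ω => (j i : ℝ) / (N (j i) ω : ℝ)) atTop id (fun _ => P)
      (L : Measure ℝ)) (t : EuclideanSpace ℝ (Fin m)) :
    Tendsto (fun i => charFun (P.map fun ω => (σ (j i) * √((j i : ℕ) : ℝ)) •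
        (randomSizeStatistic (T (j i)) (X (j i)) (N (j i)) ω - θ (j i)) - bseq (j i)) t) atTop
      (𝓝 (Complex.exp (-(inner ℝ t b * Complex.I)) * complexMGF id (L : Measure ℝ)
        (inner ℝ t a * Complex.I -
          (inner ℝ t (Matrix.toEuclideanCLM (𝕜 := ℝ) S t) : ℝ) / 2))) := by
  set z : ℂ := inner ℝ t a * Complex.I -
    (inner ℝ t (Matrix.toEuclideanCLM (𝕜 := ℝ) S t) : ℝ) / 2 with hz
  have hzre : z.re ≤ 0 := by
    have h1 := inner_toEuclideanCLM_nonneg hS.posSemidef t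
    have h2 : z.re = -(inner ℝ t (Matrix.toEuclideanCLM (𝕜 := ℝ) S t) / 2) := by
      rw [hz, Complex.sub_re, Complex.re_ofReal_mul, Complex.I_re, mul_zero, zero_sub]
      norm_cast
    linarith
  have hU : ∀ i ω, 0 ≤ (j i : ℝ) / (N (j i) ω : ℝ) := fun i ω => by positivity
  have hmain := TendstoInDistribution.tendsto_integral_of_nonneg hL hU hzre
  set H : ℕ → Ω → ℂ := fun n ω =>
    Complex.exp (((n : ℝ) / N n ω * inner ℝ t (aseq n) : ℝ) * Complex.I) *
      normalizedCharFun P T X θ aseq σ n (N n ω) (√((n : ℝ) / N n ω) • t) with hH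
  set D : ℝ → ℕ → ℕ → ℝ := fun R n k =>
    ⨆ s : Metric.closedBall (0 : EuclideanSpace ℝ (Fin m)) R,
      ‖normalizedCharFun P T X θ aseq σ n k s - (Real.exp (-(1 / 2) *
        inner ℝ (s : EuclideanSpace ℝ (Fin m)) (Matrix.toEuclideanCLM (𝕜 := ℝ) S s)) : ℂ)‖ with hD
  have hlim : Tendsto (fun i => ∫ ω, H (j i) ω ∂P) atTop (𝓝 (complexMGF id (L : Measure ℝ) z)) := by
    have hdiff : Tendsto (fun i => ∫ ω, H (j i) ω ∂P -
        ∫ ω, Complex.exp (z * ((j i : ℝ) / (N (j i) ω : ℝ) : ℝ)) ∂P) atTop (𝓝 0) := by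
      rw [Metric.tendsto_nhds]
      intro ε hε
      -- The tail probability enters with a factor `2`, so `ε / 6` leaves it a third of `ε`.
      obtain ⟨K, hK⟩ := TendstoInDistribution.exists_eventually_measureReal_lt hL
        (show 0 < ε / 6 by positivity)
      have hsup := ((hnormal (√(K : ℝ) * ‖t‖ + 1) (by positivity)).comp hj).eventually
        (gt_mem_nhds (show 0 < ε / 3 by positivity))
      have hlin : Tendsto (fun i => |(K : ℝ)| * |inner ℝ t (aseq (j i)) - inner ℝ t a|) atTop
          (𝓝 0) := by
        have h1 : Tendsto (fun i => inner ℝ t (aseq (j i))) atTop (𝓝 (inner ℝ t a)) :=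
          (((continuous_const (y := t)).inner continuous_id).tendsto a).comp (ha.comp hj)
        simpa using ((h1.sub_const (inner ℝ t a)).abs).const_mul |(K : ℝ)|
      filter_upwards [hK, hsup, hlin.eventually (gt_mem_nhds (show 0 < ε / 3 by positivity)),
        hj.eventually_ge_atTop 1] with i h1 h2 h3 h4
      rw [dist_zero_right]
      have hUm : Measurable fun ω => (j i : ℝ) / (N (j i) ω : ℝ) :=
        (Measurable.of_discrete (f := fun k : ℕ => (j i : ℝ) / (k : ℝ))).comp (hN _)
      have hH1 : ∀ ω, ‖H (j i) ω‖ ≤ 1 := fun ω => by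
        rw [hH, norm_mul, Complex.norm_exp_ofReal_mul_I, one_mul]
        exact norm_normalizedCharFun_le_one (hX _) (hT _) _ _
      have hHm : Measurable (H (j i)) :=
        (Measurable.of_discrete (f := fun k : ℕ =>
          Complex.exp (((j i : ℝ) / k * inner ℝ t (aseq (j i)) : ℝ) * Complex.I) *
            normalizedCharFun P T X θ aseq σ (j i) k (√((j i : ℝ) / k) • t))).comp (hN _)
      have hHi : Integrable (H (j i)) P :=
        Integrable.of_bound hHm.aestronglyMeasurable 1 (Eventually.of_forall hH1)
      have hEi : Integrable (fun ω => Complex.exp (z * ((j i : ℝ) / (N (j i) ω : ℝ) : ℝ))) P :=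
        Integrable.of_bound (Measurable.aestronglyMeasurable (by fun_prop)) 1
          (Eventually.of_forall fun ω => norm_cexp_mul_ofReal_le_one hzre (hU i ω))
      have hset : MeasurableSet {ω | (K : ℝ) ≤ (j i : ℝ) / (N (j i) ω : ℝ)} :=
        measurableSet_le measurable_const hUm
      -- The supremum is over an uncountable ball, but it depends on `ω` only through the integer
      -- `N`, so its measurability is automatic.
      have hDi : Integrable (fun ω => D (√(K : ℝ) * ‖t‖ + 1) (j i) (N (j i) ω)) P := by
        refine Integrable.of_bound
          ((Measurable.of_discrete (f := D (√(K : ℝ) * ‖t‖ + 1) (j i))).comp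
            (hN _)).aestronglyMeasurable 2 (Eventually.of_forall fun ω => ?_)
        rw [Real.norm_of_nonneg (Real.iSup_nonneg fun s => norm_nonneg _)]
        refine Real.iSup_le (fun s => ?_) zero_le_two
        refine (norm_sub_le _ _).trans ?_
        have e1 := norm_normalizedCharFun_le_one (P := P) (θ := θ) (a := aseq) (σ := σ) (hX (j i))
          (hT (j i)) (N (j i) ω) s
        have e2 := norm_gaussianCharFun_le_one hS.posSemidef (s : EuclideanSpace ℝ (Fin m))
        linarith
      have hIi : Integrable (fun ω => 2 * {v : ℝ | (K : ℝ) ≤ v}.indicator (fun _ => (1 : ℝ))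
          ((j i : ℝ) / (N (j i) ω : ℝ))) P :=
        ((integrable_const (1 : ℝ)).indicator hset).const_mul 2
      have hDCi : Integrable (fun ω => D (√(K : ℝ) * ‖t‖ + 1) (j i) (N (j i) ω) +
          |(K : ℝ)| * |inner ℝ t (aseq (j i)) - inner ℝ t a|) P := hDi.add (integrable_const _)
      rw [← integral_sub hHi hEi]
      calc ‖∫ ω, H (j i) ω - Complex.exp (z * ((j i : ℝ) / (N (j i) ω : ℝ) : ℝ)) ∂P‖
          ≤ ∫ ω, D (√(K : ℝ) * ‖t‖ + 1) (j i) (N (j i) ω) +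
              |(K : ℝ)| * |inner ℝ t (aseq (j i)) - inner ℝ t a| +
              2 * {v : ℝ | (K : ℝ) ≤ v}.indicator (fun _ => (1 : ℝ))
                ((j i : ℝ) / (N (j i) ω : ℝ)) ∂P := by
            refine norm_integral_le_of_norm_le (hDCi.add hIi)
              (Eventually.of_forall fun ω => ?_)
            exact norm_cexp_mul_sub_cexp_mul_le
              (norm_normalizedCharFun_le_one (hX _) (hT _) (N (j i) ω)) hS.posSemidef t (hU i ω)
        _ = ∫ ω, D (√(K : ℝ) * ‖t‖ + 1) (j i) (N (j i) ω) ∂P +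
              |(K : ℝ)| * |inner ℝ t (aseq (j i)) - inner ℝ t a| +
              2 * P.real {ω | (K : ℝ) ≤ (j i : ℝ) / (N (j i) ω : ℝ)} := by
            rw [integral_add hDCi hIi,
              integral_add hDi (integrable_const _)]
            congr 1
            · simp
            · rw [integral_const_mul]
              exact congrArg _ (integral_indicator_one hset)
        _ < ε := by
            have h2' : ∫ ω, D (√(K : ℝ) * ‖t‖ + 1) (j i) (N (j i) ω) ∂P < ε / 3 := h2
            linarith
    have h := hdiff.add hmain
    simpa using h
  have hbt : Tendsto (fun i => Complex.exp (-(inner ℝ t (bseq (j i)) * Complex.I))) atTop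
      (𝓝 (Complex.exp (-(inner ℝ t b * Complex.I)))) := by
    have hc : Continuous fun y : EuclideanSpace ℝ (Fin m) =>
        Complex.exp (-((inner ℝ t y : ℝ) * Complex.I)) := by fun_prop
    exact (hc.tendsto b).comp (hb.comp hj)
  refine (hbt.mul hlim).congr' ?_
  filter_upwards [hj.eventually_ge_atTop 1] with i hi
  exact (charFun_randomSizeStatistic (hX _) (hT _) (hN _) (hNpos _ hi)
    (fun k hk => hNindep _ k hi hk) _ t).symm

end Limit

/-- A mixing law on `[0, ∞)` is determined by the characteristic function of its normal
variance-mean mixture. -/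
theorem ext_of_complexMGF_mixture_eq {m : ℕ} (hm : 1 ≤ m) {S : Matrix (Fin m) (Fin m) ℝ}
    (hS : S.PosDef) (a : EuclideanSpace ℝ (Fin m)) {L L' : Measure ℝ} [IsProbabilityMeasure L]
    [IsProbabilityMeasure L'] (hL : ∀ᵐ x ∂L, 0 ≤ x) (hL' : ∀ᵐ x ∂L', 0 ≤ x)
    (h : ∀ t : EuclideanSpace ℝ (Fin m),
      complexMGF id L (inner ℝ t a * Complex.I -
        (inner ℝ t (Matrix.toEuclideanCLM (𝕜 := ℝ) S t) : ℝ) / 2) =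
      complexMGF id L' (inner ℝ t a * Complex.I -
        (inner ℝ t (Matrix.toEuclideanCLM (𝕜 := ℝ) S t) : ℝ) / 2)) : L = L' := by
  -- Since `m ≥ 1` there is a nonzero direction `t`; the ray `s • t` gives a parabola with `q = ⟨t,
  -- S t⟩ > 0`.
  have : Nonempty (Fin m) := ⟨⟨0, hm⟩⟩
  obtain ⟨t, ht⟩ := exists_ne (0 : EuclideanSpace ℝ (Fin m))
  have hq : 0 < inner ℝ t (Matrix.toEuclideanCLM (𝕜 := ℝ) S t) := by
    have h1 := hS.dotProduct_mulVec_pos (x := t.ofLp) (by simpa using ht)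
    rw [EuclideanSpace.inner_eq_star_dotProduct]
    simpa [dotProduct_comm] using h1
  refine ext_of_complexMGF_eq_on_parabola hL hL' (p := inner ℝ t a) hq fun s => ?_
  have h1 := h (s • t)
  rw [map_smul, real_inner_smul_left, real_inner_smul_left, real_inner_smul_right, ← mul_assoc s s,
    ← sq, ← Complex.ofReal_ofNat, ← Complex.ofReal_div] at h1
  exact h1

/-! ### The equivalence -/

theorem theorem4 {Ω : Type*} [MeasurableSpace Ω] (P : Measure Ω) [IsProbabilityMeasure P]
    (m r : ℕ) (hm : 1 ≤ m)
    -- the observations, independent within each row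
    (X : ℕ → ℕ → Ω → EuclideanSpace ℝ (Fin r))
    (hX : ∀ n j, Measurable (X n j))
    (hXindep : ∀ n, 1 ≤ n → iIndepFun (X n) P)
    -- the statistics
    (T : ℕ → (k : ℕ) → (Fin k → EuclideanSpace ℝ (Fin r)) → EuclideanSpace ℝ (Fin m))
    (hT : ∀ n k, Measurable (T n k))
    (θ : ℕ → EuclideanSpace ℝ (Fin m))
    -- the random sample sizes
    (N : ℕ → Ω → ℕ)
    (hN : ∀ n, Measurable (N n))
    (hNpos : ∀ n, 1 ≤ n → ∀ᵐ ω ∂P, 1 ≤ N n ω)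
    (hNindep : ∀ n k, 1 ≤ n → 1 ≤ k →
      IndepFun (N n) (fun ω => statistic (T n) (X n) k ω - θ n) P)
    (hNcomp : WeaklyRelativelyCompact P fun n ω => (n : ℝ) / (N n ω : ℝ))
    -- the normalizing constants
    (σ : ℕ → ℝ) (hσ : ∀ n, 1 ≤ n → 0 < σ n)
    (aseq bseq : ℕ → EuclideanSpace ℝ (Fin m)) (a b : EuclideanSpace ℝ (Fin m))
    (ha : Tendsto aseq atTop (𝓝 a)) (hb : Tendsto bseq atTop (𝓝 b))
    -- asymptotic normality
    (S : Matrix (Fin m) (Fin m) ℝ) (hS : S.PosDef)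
    (hnormal : ∀ R : ℝ, 0 < R → Tendsto (fun n : ℕ =>
        ∫ ω, (⨆ t : Metric.closedBall (0 : EuclideanSpace ℝ (Fin m)) R,
          ‖normalizedCharFun P T X θ aseq σ n (N n ω) t -
            (Real.exp (-(1 / 2) *
              inner ℝ (t : EuclideanSpace ℝ (Fin m)) (Matrix.toEuclideanCLM (𝕜 := ℝ) S t)) : ℂ)‖) ∂P)
      atTop (𝓝 0))
    -- the parameters of the limit law
    (ν μ α : ℝ) (hpar : GHParam ν μ α (Matrix.toEuclideanCLM (𝕜 := ℝ) S⁻¹ a) S) :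
    TendstoInDistribution
        (fun n ω => (σ n * √(n : ℝ)) • (randomSizeStatistic (T n) (X n) (N n) ω - θ n) - bseq n)
        atTop id (fun _ => P)
        (GH ν μ α (Matrix.toEuclideanCLM (𝕜 := ℝ) S⁻¹ a) (-b) S hS hpar :
          Measure (EuclideanSpace ℝ (Fin m))) ↔
      TendstoInDistribution (fun n ω => (N n ω : ℝ) / (n : ℝ)) atTop id (fun _ => P)
        (GIG (-ν) (√(α ^ 2 - inner ℝ a (Matrix.toEuclideanCLM (𝕜 := ℝ) S⁻¹ a))) μ
          (hpar.gigParam_neg hS) : Measure ℝ) := by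
  have hS' : Matrix.toEuclideanCLM (𝕜 := ℝ) S (Matrix.toEuclideanCLM (𝕜 := ℝ) S⁻¹ a) = a := by
    rw [← mul_apply_eq_comp, ← map_mul, Matrix.mul_nonsing_inv _
      ((Matrix.isUnit_iff_isUnit_det _).1 hS.isUnit), map_one]
    rfl
  have hlam : inner ℝ (Matrix.toEuclideanCLM (𝕜 := ℝ) S⁻¹ a) (Matrix.toEuclideanCLM (𝕜 := ℝ) S
      (Matrix.toEuclideanCLM (𝕜 := ℝ) S⁻¹ a)) =
      inner ℝ a (Matrix.toEuclideanCLM (𝕜 := ℝ) S⁻¹ a) := by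
    rw [hS', real_inner_comm]
  have hG := hpar.gigParam
  rw [hlam] at hG
  set lam := √(α ^ 2 - inner ℝ a (Matrix.toEuclideanCLM (𝕜 := ℝ) S⁻¹ a)) with hlamdef
  have hGH : (GH ν μ α (Matrix.toEuclideanCLM (𝕜 := ℝ) S⁻¹ a) (-b) S hS hpar :
      Measure (EuclideanSpace ℝ (Fin m))) = normalMixture a (-b) S (GIG ν μ lam hG : Measure ℝ) := by
    change normalMixture _ _ _ (gigMeasure ν μ _) = normalMixture _ _ _ (gigMeasure ν μ _)
    rw [hlam, hS']
  have hG0 : ∀ᵐ x ∂(GIG ν μ lam hG : Measure ℝ), 0 ≤ x := ae_nonneg_gigMeasure _ _ _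
  have hchar : ∀ t, charFun (GH ν μ α (Matrix.toEuclideanCLM (𝕜 := ℝ) S⁻¹ a) (-b) S hS hpar :
      Measure (EuclideanSpace ℝ (Fin m))) t = Complex.exp (-(inner ℝ t b * Complex.I)) *
        complexMGF id (GIG ν μ lam hG : Measure ℝ) (inner ℝ t a * Complex.I -
          (inner ℝ t (Matrix.toEuclideanCLM (𝕜 := ℝ) S t) : ℝ) / 2) := fun t => by
    rw [hGH, charFun_normalMixture hS _ _ hG0, inner_neg_right, Complex.ofReal_neg, neg_mul]
    congr 1
    refine integral_congr_ae (Eventually.of_forall fun x => ?_)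
    simp only [id, mul_comm]
  have hZm : ∀ n, Measurable fun ω => (σ n * √(n : ℝ)) •
      (randomSizeStatistic (T n) (X n) (N n) ω - θ n) - bseq n := fun n => by
    have : Measurable (randomSizeStatistic (T n) (X n) (N n)) :=
      measurable_randomIndex (hN n) (measurable_statistic (hT n) (hX n))
    fun_prop
  have hUm : ∀ n : ℕ, Measurable fun ω => (n : ℝ) / (N n ω : ℝ) := fun n =>
    (Measurable.of_discrete (f := fun k : ℕ => (n : ℝ) / (k : ℝ))).comp (hN n)
  constructor
  · intro h
    have hZ := TendstoInDistribution.tendsto_toProbabilityMeasure h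
    have hU : TendstoInDistribution (fun (n : ℕ) ω => (n : ℝ) / (N n ω : ℝ)) atTop id (fun _ => P)
        (GIG ν μ lam hG : Measure ℝ) := by
      refine tendstoInDistribution_id_of_tendsto (fun n => (hUm n).aemeasurable) ?_
      -- It suffices that every sequence of indices tending to infinity has a further subsequence
      -- with the right limit; compactness provides some limit `L`, and identifiability forces it to
      -- be the GIG law.
      refine tendsto_of_subseq_tendsto fun j hj => ?_
      obtain ⟨φ, hφ, L, hL⟩ := hNcomp j
      refine ⟨φ, ?_⟩
      have hjφ : Tendsto (fun i => j (φ i)) atTop atTop := hj.comp hφ.tendsto_atTop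
      have hL0 := TendstoInDistribution.ae_nonneg hL fun i ω => by positivity
      have hLG : (L : Measure ℝ) = GIG ν μ lam hG := by
        refine ext_of_complexMGF_mixture_eq hm hS a hL0 hG0 fun t => ?_
        have h1 := tendsto_charFun_randomSizeStatistic hX hT hN hNpos hNindep ha hb hS hnormal
          hjφ hL t
        have h2 := (ProbabilityMeasure.tendsto_iff_tendsto_charFun.1 (hZ.comp hjφ) t)
        rw [hchar] at h2
        exact mul_left_cancel₀ (Complex.exp_ne_zero _) (tendsto_nhds_unique h1 h2)
      rw [← show L = GIG ν μ lam hG from Subtype.ext hLG]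
      exact TendstoInDistribution.tendsto_toProbabilityMeasure hL
    have h1 := TendstoInDistribution.inv (L' := GIG (-ν) lam μ (hpar.gigParam_neg hS)) hU
      ((ae_pos_gigMeasure _ _ _).mono fun x hx => hx.ne') (map_inv_gigMeasure _ _ _)
    -- With division by zero equal to zero, `(n / N)⁻¹ = N / n` holds everywhere, including where `N
    -- = 0` or `n = 0`.
    simpa only [inv_div] using h1
  · intro h
    have hU := TendstoInDistribution.inv (L' := GIG ν μ lam hG) h
      ((ae_pos_gigMeasure _ _ _).mono fun x hx => hx.ne')
      ((map_inv_gigMeasure _ _ _).trans (by rw [neg_neg]; rfl))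
    simp only [inv_div] at hU
    refine tendstoInDistribution_id_of_tendsto (fun n => (hZm n).aemeasurable) ?_
    refine ProbabilityMeasure.tendsto_iff_tendsto_charFun.2 fun t => ?_
    rw [hchar]
    -- Here the whole sequence of `n / N` converges, so the limit lemma is used without passing to a
    -- subsequence and tightness comes from convergence itself.
    exact tendsto_charFun_randomSizeStatistic hX hT hN hNpos hNindep ha hb hS hnormal
      tendsto_id hU t
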